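/- \textbf{Theorem 2.} A \emph{$3$-tree} is a finite simple graph $G$ that is edge-maximal of treewidth $3$: $G$ has treewidth $3$, and no graph on the same vertex set whose edge set properly contains that of $G$ has treewidth $3$. An \emph{L-shape of rotation ``L''} is a set $\big(\{x\}\times[y,y+h]\big)\cup\big([x,x+w]\times\{y\}\big)\subset\mathbb{R}^2$ with $x,y\in\mathbb{R}$ and $h,w>0$. A graph is an \emph{$\{\mathrm{L}\}$-graph} if one can assign to each of its vertices an L-shape of rotation ``L'' so that two distinct vertices are adjacent if and only if their L-shapes intersect. Every planar $3$-tree is an $\{\mathrm{L}\}$-graph. -/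

import Mathlib

/-! ## Planar graphs -/

/-- A drawing of the simple graph `G` in the plane without crossings: vertices are distinct points,
each edge `uv` is a simple arc (an injective path) joining the points of `u` and `v`, an arc passes
through no vertex other than its two ends, and two distinct edges meet only in common end vertices.
The arc of an edge does not depend on the direction in which the edge is read, up to reversal. -/
structure PlaneDrawing {V : Type*} (G : SimpleGraph V) where
  /-- the point that represents a vertex -/
  point : V → ℝ × ℝ
  /-- the arc that represents an edge -/
  arc : ∀ u v : V, G.Adj u v → Path (point u) (point v)
  point_injective : Function.Injective point
  arc_injective : ∀ (u v : V) (h : G.Adj u v), Function.Injective (arc u v h)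
  arc_symm : ∀ (u v : V) (h : G.Adj u v), arc v u h.symm = (arc u v h).symm
  vertex_on_arc : ∀ (u v : V) (h : G.Adj u v) (w : V),
    point w ∈ Set.range (arc u v h) → w = u ∨ w = v
  arc_inter : ∀ (u v : V) (h : G.Adj u v) (x y : V) (h' : G.Adj x y), s(u, v) ≠ s(x, y) →
    ∀ z ∈ Set.range (arc u v h) ∩ Set.range (arc x y h'),
      ∃ w : V, (w = u ∨ w = v) ∧ (w = x ∨ w = y) ∧ z = point w

/-- A graph is planar if it can be drawn in the plane without crossings. -/
def IsPlanarGraph {V : Type*} (G : SimpleGraph V) : Prop :=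
  Nonempty (PlaneDrawing G)

/-! ## Treewidth and `k`-trees -/

/-- A tree decomposition of `G`: a finite tree with a finite set of vertices of `G` (a bag) at each
node, such that both ends of every edge lie in a common bag and, for each vertex `v`, the nodes
whose bags contain `v` induce a non-empty connected subgraph of the tree. -/
structure TreeDecomposition {V : Type*} (G : SimpleGraph V) where
  /-- the number of nodes of the tree -/
  size : ℕ
  /-- the tree -/
  tree : SimpleGraph (Fin size)
  /-- the bag at a node -/
  bag : Fin size → Finset V
  isTree : tree.IsTree
  edge_covered : ∀ u v : V, G.Adj u v → ∃ i, u ∈ bag i ∧ v ∈ bag i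
  connected : ∀ v : V, (tree.induce {i | v ∈ bag i}).Connected

/-- The treewidth of a finite graph: the least `k` such that there is a tree decomposition all of
whose bags have at most `k + 1` elements. -/
noncomputable def graphTreewidth {V : Type*} (G : SimpleGraph V) : ℕ :=
  sInf {k : ℕ | ∃ D : TreeDecomposition G, ∀ i, (D.bag i).card ≤ k + 1}

/-- A `k`-tree is an edge-maximal graph of treewidth `k`: its treewidth is `k`, and no graph with
the same vertices and strictly more edges has treewidth `k`. -/
def IsKTree {V : Type*} (k : ℕ) (G : SimpleGraph V) : Prop :=
  Maximal (fun H : SimpleGraph V => graphTreewidth H = k) G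

/-! ## Intersection graphs of L-shapes -/

/-- An axis-aligned L-shape in the rotation of the letter "L": the vertical segment goes up from
the corner, and the horizontal segment goes to the right from the corner. -/
structure LShape where
  /-- the corner -/
  corner : ℝ × ℝ
  /-- the length of the vertical segment -/
  height : ℝ
  /-- the length of the horizontal segment -/
  width : ℝ
  height_pos : 0 < height
  width_pos : 0 < width

/-- The points of an L-shape. -/
def LShape.toSet (P : LShape) : Set (ℝ × ℝ) :=
  {P.corner.1} ×ˢ Set.Icc P.corner.2 (P.corner.2 + P.height) ∪
    Set.Icc P.corner.1 (P.corner.1 + P.width) ×ˢ {P.corner.2}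

/-- `G` is an {L}-graph: its vertices can be represented by L-shapes in the rotation "L" so that
two distinct vertices are adjacent if and only if their L-shapes intersect. -/
def IsLGraph {V : Type*} (G : SimpleGraph V) : Prop :=
  ∃ P : V → LShape, ∀ u v : V, u ≠ v →
    (G.Adj u v ↔ ((P u).toSet ∩ (P v).toSet).Nonempty)

/-! A 3-tree grows from a triangle by adding vertices one at a time, each adjacent to exactly the
three vertices of an existing triangle (`StackedFrom`). L-shapes are drawn in the same order. A
triangle still open for stacking owns a private region: a comb, or its mirror image, which two of
its L-shapes cross as parallel lines and the third as a perpendicular line, and which no other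
L-shape meets. An L drawn inside the comb meets precisely these three and leaves room for three
disjoint combs, one for each new triangle (`IsComb.exists_insert`). One of these is reflected in the
diagonal, which is harmless because that reflection preserves the rotation "L".

Each region is used once. A triangle created by stacking already has a common neighbour, the vertex
omitted from the old triangle, so stacking on it twice would give three common neighbours and hence
a `K₃,₃`, contrary to planarity. Only the base triangle starts without a common neighbour. It is
therefore chosen to have at most one in the whole graph: the last stacked vertex together with two
of its neighbours (`StackedFrom.exists_base_unique_common_neighbor`, by `StackedFrom.rebase`).

That a 3-tree is stacked follows from a tree decomposition of width 3: repeatedly removing the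
vertex whose subtree has the deepest top embeds the graph in a stacked one
(`exists_stackedFrom_of_bags`), and maximality gives equality. Nonplanarity of `K₃,₃` is a parity
count of winding numbers of differences of points on independent edges. -/

/-! ## Nonplanarity of `K₃,₃` -/

section CompleteBipartite

open Complex

/-- A nowhere vanishing continuous function on a real normed space has a continuous logarithm. -/
theorem exists_continuous_log {E : Type*} [NormedAddCommGroup E] [NormedSpace ℝ E] {f : E → ℂ}
    (hf : Continuous f) (h0 : ∀ z, f z ≠ 0) : ∃ F : E → ℂ, Continuous F ∧ ∀ z, exp (F z) = f z := by
  obtain ⟨F, ⟨-, hF⟩, -⟩ := isCoveringMapOn_exp.existsUnique_continuousMap_lifts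
    (⟨f, hf⟩ : C(E, ℂ)) (a₀ := 0) (exp_log (h0 0)) (fun z => by simpa using h0 z)
  exact ⟨F, F.continuous, fun z => by simpa using congr($hF z)⟩

/-- Two continuous logarithms of the same function increase by the same amount. -/
theorem log_increment_unique {F G : ℝ → ℂ} (hF : Continuous F) (hG : Continuous G)
    (h : ∀ t, exp (F t) = exp (G t)) : F 1 - F 0 = G 1 - G 0 := by
  have key : F = fun t => G t + (F 0 - G 0) := by
    refine isCoveringMap_exp.eq_of_comp_eq hF (by fun_prop) ?_ 0 (by simp)
    funext t
    simp [exp_add, exp_sub, h]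
  have := congrFun key 1
  linear_combination this

/-- The amount by which a continuous logarithm of `f` increases from `0` to `1`. -/
noncomputable def logIncrement (f : ℝ → ℂ) : ℂ :=
  open Classical in
  if h : ∃ F : ℝ → ℂ, Continuous F ∧ ∀ t, exp (F t) = f t then h.choose 1 - h.choose 0 else 0

theorem logIncrement_eq {f F : ℝ → ℂ} (hF : Continuous F) (h : ∀ t, exp (F t) = f t) :
    logIncrement f = F 1 - F 0 := by
  have hex : ∃ F : ℝ → ℂ, Continuous F ∧ ∀ t, exp (F t) = f t := ⟨F, hF, h⟩
  rw [logIncrement, dif_pos hex]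
  exact log_increment_unique hex.choose_spec.1 hF fun t => by rw [hex.choose_spec.2, h]

theorem exp_logIncrement {f : ℝ → ℂ} (hf : Continuous f) (h0 : ∀ t, f t ≠ 0) :
    exp (logIncrement f) = f 1 / f 0 := by
  obtain ⟨F, hF, h⟩ := exists_continuous_log hf h0
  rw [logIncrement_eq hF h, exp_sub, h, h]

theorem logIncrement_neg {f : ℝ → ℂ} (hf : Continuous f) (h0 : ∀ t, f t ≠ 0) :
    logIncrement (fun t => - f t) = logIncrement f := by
  obtain ⟨F, hF, h⟩ := exists_continuous_log hf h0
  have h' : ∀ t, exp (F t + Real.pi * I) = - f t := fun t => by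
    rw [exp_add, h, exp_pi_mul_I]; ring
  rw [logIncrement_eq hF h, logIncrement_eq (by fun_prop) h']
  ring

/-- The increments of the logarithm along the boundary of a square add up to zero. -/
theorem logIncrement_square {f : ℝ × ℝ → ℂ} (hf : Continuous f) (h0 : ∀ z, f z ≠ 0) :
    logIncrement (fun s => f (s, 0)) + logIncrement (fun t => f (1, t)) =
      logIncrement (fun t => f (0, t)) + logIncrement (fun s => f (s, 1)) := by
  obtain ⟨F, hF, h⟩ := exists_continuous_log hf h0
  rw [logIncrement_eq (F := fun s => F (s, 0)) (by fun_prop) fun _ => h _,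
    logIncrement_eq (F := fun t => F (1, t)) (by fun_prop) fun _ => h _,
    logIncrement_eq (F := fun t => F (0, t)) (by fun_prop) fun _ => h _,
    logIncrement_eq (F := fun s => F (s, 1)) (by fun_prop) fun _ => h _]
  ring

/-- Logarithms of the differences of distinct complex numbers, chosen so that the logarithms of
opposite differences differ by `π i`. -/
theorem exists_log_differences {ι : Type*} [LinearOrder ι] {a : ι → ℂ}
    (ha : Function.Injective a) : ∃ A : ι → ι → ℂ, (∀ i k, i ≠ k → exp (A i k) = a i - a k) ∧
      ∀ i k, i < k → A k i = A i k + Real.pi * I := by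
  refine ⟨fun i k => if i < k then log (a i - a k) else log (a k - a i) + Real.pi * I, ?_, ?_⟩
  · intro i k hik
    dsimp only
    split_ifs with h
    · exact exp_log (sub_ne_zero.2 (ha.ne hik))
    · rw [exp_add, exp_log (sub_ne_zero.2 (ha.ne hik.symm)), exp_pi_mul_I]
      ring
  · intro i k hik
    simp [hik, hik.not_gt]

/-- In the plane, nine curves that join each of three points to each of three points cannot be
such that curves without a common end are disjoint. -/
theorem no_disjoint_curves_of_completeBipartite (γ : Fin 3 → Fin 3 → ℝ → ℂ) (a b : Fin 3 → ℂ)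
    (hγ : ∀ i j, Continuous (γ i j)) (h0 : ∀ i j, γ i j 0 = a i) (h1 : ∀ i j, γ i j 1 = b j)
    (hab : ∀ i j, a i ≠ b j)
    (hd : ∀ i j k l, i ≠ k → j ≠ l → ∀ s t, γ i j s ≠ γ k l t) : False := by
  have other : ∀ j : Fin 3, ∃ l, j ≠ l := by decide
  have haγ : ∀ i j k, i ≠ k → ∀ t, γ i j t - a k ≠ 0 := fun i j k hik t => by
    obtain ⟨l, hl⟩ := other j
    rw [← h0 k l]
    exact sub_ne_zero.2 (hd i j k l hik hl t 0)
  have hbγ : ∀ i j l, j ≠ l → ∀ t, γ i j t - b l ≠ 0 := fun i j l hjl t => by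
    obtain ⟨k, hk⟩ := other i
    rw [← h1 k l]
    exact sub_ne_zero.2 (hd i j k l hk hjl t 1)
  have ha : Function.Injective a := fun i k hik => by
    by_contra hne
    have := haγ i 0 k hne 0
    rw [h0, hik, sub_self] at this
    exact this rfl
  have hb : Function.Injective b := fun j l hjl => by
    by_contra hne
    have := hbγ 0 j l hne 1
    rw [h1, hjl, sub_self] at this
    exact this rfl
  obtain ⟨A, hA, hA'⟩ := exists_log_differences ha
  obtain ⟨B, hB, hB'⟩ := exists_log_differences hb
  have hC : ∀ i j, exp (log (b j - a i)) = b j - a i := fun i j =>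
    exp_log (sub_ne_zero.2 (hab i j).symm)
  -- Relative to fixed logarithms of the differences of end points, each increment has an integer
  -- error. The value 0 for `i = k` only makes `n` total, so that `choose` applies; likewise for
  -- `m`.
  have hn : ∀ i j k, ∃ n : ℤ, i ≠ k → logIncrement (fun t => γ i j t - a k) =
      log (b j - a k) - A i k + n * (2 * Real.pi * I) := fun i j k => by
    by_cases hik : i = k
    · exact ⟨0, fun h => (h hik).elim⟩
    · have hc := hγ i j
      have : exp (logIncrement (fun t => γ i j t - a k)) = exp (log (b j - a k) - A i k) := by
        rw [exp_logIncrement (by fun_prop) (haγ i j k hik), exp_sub, hC, hA i k hik, h0, h1]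
      obtain ⟨n, hn⟩ := exp_eq_exp_iff_exists_int.1 this
      exact ⟨n, fun _ => hn⟩
  have hm : ∀ i j l, ∃ m : ℤ, j ≠ l → logIncrement (fun t => γ i j t - b l) =
      B j l - (log (b l - a i) + Real.pi * I) + m * (2 * Real.pi * I) := fun i j l => by
    by_cases hjl : j = l
    · exact ⟨0, fun h => (h hjl).elim⟩
    · have hc := hγ i j
      have : exp (logIncrement (fun t => γ i j t - b l)) =
          exp (B j l - (log (b l - a i) + Real.pi * I)) := by
        rw [exp_logIncrement (by fun_prop) (hbγ i j l hjl), exp_sub, exp_add, hC, hB j l hjl, h0,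
          h1, exp_pi_mul_I]
        congr 1
        ring
      obtain ⟨n, hn⟩ := exp_eq_exp_iff_exists_int.1 this
      exact ⟨n, fun _ => hn⟩
  choose n hn using hn
  choose m hm using hm
  have square : ∀ i j k l, i ≠ k → j ≠ l →
      logIncrement (fun t => γ i j t - a k) + logIncrement (fun t => γ k l t - b j) =
        logIncrement (fun t => γ k l t - a i) + logIncrement (fun t => γ i j t - b l) := by
    intro i j k l hik hjl
    have hc := hγ i j
    have hc' := hγ k l
    -- For two independent edges the difference of their points never vanishes on the parameter
    -- square, so it has no winding along the boundary.
    have := logIncrement_square (f := fun z => γ i j z.1 - γ k l z.2) (by fun_prop)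
      fun z => sub_ne_zero.2 (hd i j k l hik hjl _ _)
    simp only [h0, h1] at this
    rw [← logIncrement_neg (by fun_prop) (hbγ k l j hjl.symm),
      ← logIncrement_neg (by fun_prop) (haγ k l i hik.symm)]
    simpa only [neg_sub] using this
  have hpi : (2 * Real.pi * I : ℂ) ≠ 0 := by simp [Real.pi_ne_zero]
  -- The fixed logarithms cancel up to the jumps `π i` of `A` and `B` under exchange of indices. If
  -- both pairs are increasing the jumps add to `2 π i`, whence `-1`; if the orders are opposite
  -- they cancel, whence `0` in `gt_case`.
  have lt_case : ∀ i j k l, i < k → j < l → n i j k + m k l j - n k l i - m i j l = -1 := by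
    intro i j k l hik hjl
    have := square i j k l hik.ne hjl.ne
    rw [hn _ _ _ hik.ne, hm _ _ _ hjl.ne', hn _ _ _ hik.ne', hm _ _ _ hjl.ne, hA' i k hik,
      hB' j l hjl] at this
    have : ((n i j k + m k l j - n k l i - m i j l + 1 : ℤ) : ℂ) * (2 * Real.pi * I) = 0 := by
      push_cast
      linear_combination this
    have := (mul_eq_zero.1 this).resolve_right hpi
    have : n i j k + m k l j - n k l i - m i j l + 1 = 0 := by exact_mod_cast this
    omega
  have gt_case : ∀ i j k l, i < k → l < j → n i j k + m k l j - n k l i - m i j l = 0 := by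
    intro i j k l hik hjl
    have := square i j k l hik.ne hjl.ne'
    rw [hn _ _ _ hik.ne, hm _ _ _ hjl.ne, hn _ _ _ hik.ne', hm _ _ _ hjl.ne', hA' i k hik,
      hB' l j hjl] at this
    have : ((n i j k + m k l j - n k l i - m i j l : ℤ) : ℂ) * (2 * Real.pi * I) = 0 := by
      push_cast
      linear_combination this
    have := (mul_eq_zero.1 this).resolve_right hpi
    exact_mod_cast this
  have l01 : (0 : Fin 3) < 1 := by decide
  have l02 : (0 : Fin 3) < 2 := by decide
  have l12 : (1 : Fin 3) < 2 := by decide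
  have both : ∀ i k : Fin 3, i < k →
      (n i 0 k + m k 1 0 - n k 1 i - m i 0 1 = -1 ∧ n i 0 k + m k 2 0 - n k 2 i - m i 0 2 = -1 ∧
        n i 1 k + m k 2 1 - n k 2 i - m i 1 2 = -1) ∧
      (n i 1 k + m k 0 1 - n k 0 i - m i 1 0 = 0 ∧ n i 2 k + m k 0 2 - n k 0 i - m i 2 0 = 0 ∧
        n i 2 k + m k 1 2 - n k 1 i - m i 2 1 = 0) := fun i k hik =>
    ⟨⟨lt_case i 0 k 1 hik l01, lt_case i 0 k 2 hik l02, lt_case i 1 k 2 hik l12⟩,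
      gt_case i 1 k 0 hik l01, gt_case i 2 k 0 hik l02, gt_case i 2 k 1 hik l12⟩
  have h01 := both 0 1 l01
  have h02 := both 0 2 l02
  have h12 := both 1 2 l12
  clear lt_case gt_case both square hn hm
  -- Parity: every `n` and every `m` occurs with coefficient `±1` in exactly two of the 18
  -- equations, while the right sides contain `-1` nine times.
  omega

/-- A graph that contains `K₃,₃` is not planar. -/
theorem not_isPlanarGraph_of_completeBipartite {V : Type*} {G : SimpleGraph V} {a b : Fin 3 → V}
    (ha : Function.Injective a) (hb : Function.Injective b) (hab : ∀ i j, G.Adj (a i) (b j)) :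
    ¬ IsPlanarGraph G := by
  rintro ⟨D⟩
  let e := equivRealProdCLM.symm
  have he : Function.Injective e := e.injective
  refine no_disjoint_curves_of_completeBipartite
    (fun i j t => e ((D.arc _ _ (hab i j)).extend t)) (fun i => e (D.point (a i)))
    (fun j => e (D.point (b j))) (fun i j => by fun_prop) (by simp) (by simp)
    (fun i j h => (hab i j).ne (D.point_injective (he h))) ?_
  intro i j k l hik hjl s t hst
  have hmem : ∀ i j s, (D.arc _ _ (hab i j)).extend s ∈ Set.range (D.arc _ _ (hab i j)) :=
    fun i j s => by rw [← Path.extend_range]; exact Set.mem_range_self s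
  have hne : s(a i, b j) ≠ s(a k, b l) := by
    rw [Ne, Sym2.eq_iff]
    rintro (h | h)
    · exact hik (ha h.1)
    · exact (hab i l).ne h.1
  obtain ⟨w, h, h', -⟩ := D.arc_inter _ _ (hab i j) _ _ (hab k l) hne _
    ⟨hmem i j s, by rw [he hst]; exact hmem k l t⟩
  rcases h with rfl | rfl <;> rcases h' with h' | h'
  · exact hik (ha h')
  · exact (hab i l).ne h'
  · exact (hab k j).ne h'.symm
  · exact hjl (hb h')

end CompleteBipartite

/-! ## Stacking vertices on triangles -/

/-- `StackedFrom G T₀ S`: the vertices of `S` are obtained from those of `T₀` by adding them one by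
one, such that each of them is adjacent in `G` to exactly three of the vertices before it, and these
three form a triangle. -/
inductive StackedFrom {V : Type*} [DecidableEq V] (G : SimpleGraph V) (T₀ : Finset V) :
    Finset V → Prop
  | base : StackedFrom G T₀ T₀
  | step {S T : Finset V} {x : V} (hS : StackedFrom G T₀ S) (hx : x ∉ S) (hTS : T ⊆ S)
      (hT : G.IsNClique 3 T) (hadj : ∀ y ∈ S, G.Adj x y ↔ y ∈ T) : StackedFrom G T₀ (insert x S)

theorem SimpleGraph.IsNClique.of_adj_iff {V : Type*} {G H : SimpleGraph V} {n : ℕ}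
    {S T : Finset V} (hT : G.IsNClique n T)
    (hTS : T ⊆ S) (h : ∀ u ∈ S, ∀ v ∈ S, G.Adj u v ↔ H.Adj u v) : H.IsNClique n T :=
  ⟨fun u hu v hv huv => (h u (hTS hu) v (hTS hv)).1 (hT.1 hu hv huv), hT.2⟩

namespace StackedFrom

variable {V : Type*} [DecidableEq V] {G H : SimpleGraph V} {T₀ S : Finset V}

theorem base_subset (h : StackedFrom G T₀ S) : T₀ ⊆ S := by
  induction h with
  | base => exact subset_rfl
  | step hS hx hTS hT hadj ih => exact ih.trans (Finset.subset_insert _ _)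

theorem of_adj_iff (hS : StackedFrom G T₀ S) (h : ∀ u ∈ S, ∀ v ∈ S, G.Adj u v ↔ H.Adj u v) :
    StackedFrom H T₀ S := by
  induction hS with
  | base => exact .base
  | @step S T x hS hx hTS hT hadj ih =>
    have h' : ∀ u ∈ S, ∀ v ∈ S, G.Adj u v ↔ H.Adj u v := fun u hu v hv =>
      h u (Finset.mem_insert_of_mem hu) v (Finset.mem_insert_of_mem hv)
    refine .step (ih h') hx hTS (hT.of_adj_iff hTS h') fun y hy => ?_
    rw [← hadj y hy, h x (Finset.mem_insert_self _ _) y (Finset.mem_insert_of_mem hy)]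

/-- In a stacked graph, a clique with at most three vertices is contained in a triangle. -/
theorem exists_triangle_superset (hS : StackedFrom G T₀ S) (hT₀ : G.IsNClique 3 T₀)
    {K : Finset V} (hKS : K ⊆ S) (hK : G.IsClique (K : Set V)) (hK3 : K.card ≤ 3) :
    ∃ T ⊆ S, K ⊆ T ∧ G.IsNClique 3 T := by
  induction hS with
  | base => exact ⟨T₀, subset_rfl, hKS, hT₀⟩
  | @step S T x hS hx hTS hT hadj ih =>
    by_cases hxK : x ∈ K
    · have hKT : K.erase x ⊆ T := fun y hy => by
        have hy' := Finset.mem_erase.1 hy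
        exact (hadj y ((Finset.mem_insert.1 (hKS hy'.2)).resolve_left hy'.1)).1
          (hK hxK hy'.2 hy'.1.symm)
      have hcard : (K.erase x).card ≤ 2 := by
        rw [Finset.card_erase_of_mem hxK]; omega
      obtain ⟨K', h1, h2, h3⟩ := Finset.exists_subsuperset_card_eq hKT hcard (by rw [hT.2]; omega)
      refine ⟨insert x K', Finset.insert_subset_insert _ (h2.trans hTS), ?_, ?_⟩
      · rw [← Finset.insert_erase hxK]
        exact Finset.insert_subset_insert _ h1
      · exact SimpleGraph.IsNClique.insert ⟨hT.1.subset (by exact_mod_cast h2), h3⟩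
          fun y hy => (hadj y (hTS (h2 hy))).2 (h2 hy)
    · obtain ⟨T', h1, h2, h3⟩ := ih fun y hy =>
        (Finset.mem_insert.1 (hKS hy)).resolve_left fun h => hxK (h ▸ hy)
      exact ⟨T', h1.trans (Finset.subset_insert _ _), h2, h3⟩

/-- If `x` is stacked on the initial triangle, then the stacking can also begin with `x` and two of
the vertices of that triangle. -/
theorem insert_of_adj_base {T : Finset V} (hS : StackedFrom G T S) (hT : G.IsNClique 3 T) {x c : V}
    (hx : x ∉ S) (hadj : ∀ y ∈ S, G.Adj x y ↔ y ∈ T) (hc : c ∈ T) :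
    -- The vertices `x` and `c` exchange roles: `c` is stacked first, on `x` and the other two
    -- vertices of `T`. All later vertices keep their triangles, since none of them is adjacent to
    -- `x`.
    StackedFrom G (insert x (T.erase c)) (insert x S) := by
  induction hS with
  | base =>
    have hxT : ∀ y ∈ T, G.Adj x y := fun y hy => (hadj y hy).2 hy
    have heq : insert x T = insert c (insert x (T.erase c)) := by
      rw [Finset.insert_comm, Finset.insert_erase hc]
    have hall : ∀ y ∈ insert x (T.erase c), G.Adj c y := fun y hy => by
      rcases Finset.mem_insert.1 hy with rfl | hy
      · exact (hxT c hc).symm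
      · exact hT.1 hc (Finset.mem_of_mem_erase hy) (Finset.ne_of_mem_erase hy).symm
    rw [heq]
    refine .step .base (fun h => (hall c h).ne rfl) subset_rfl ?_ fun y hy => by simp [hall y hy, hy]
    refine SimpleGraph.IsNClique.insert ⟨hT.1.subset (by simp), ?_⟩ fun y hy =>
      hxT y (Finset.mem_of_mem_erase hy)
    rw [Finset.card_erase_of_mem hc, hT.2]
  | @step S U z hS hz hUS hU hadjz ih =>
    have hxz : z ≠ x := fun h => hx (h ▸ Finset.mem_insert_self _ _)
    have hxS : x ∉ S := fun h => hx (Finset.mem_insert_of_mem h)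
    rw [Finset.insert_comm]
    refine .step (ih hxS fun y hy => hadj y (Finset.mem_insert_of_mem hy))
      (by simp [hxz, hz]) (hUS.trans (Finset.subset_insert _ _)) hU fun y hy => ?_
    rcases Finset.mem_insert.1 hy with rfl | hy
    · rw [G.adj_comm, hadj z (Finset.mem_insert_self _ _)]
      exact iff_of_false (fun h => hz (hS.base_subset h)) fun h => hxS (hUS h)
    · exact hadjz y hy

/-- The stacking can begin with any triangle. -/
theorem rebase (hS : StackedFrom G T₀ S) (hT₀ : G.IsNClique 3 T₀) {Q : Finset V} (hQS : Q ⊆ S)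
    (hQ : G.IsNClique 3 Q) : StackedFrom G Q S := by
  induction hS generalizing Q with
  | base =>
    rw [Finset.eq_of_subset_of_card_le hQS (by rw [hQ.2, hT₀.2])]
    exact .base
  | @step S T x hS hx hTS hT hadj ih =>
    by_cases hxQ : x ∈ Q
    -- A triangle through the last vertex `x` consists of `x` and two vertices of `T`, so it
    -- suffices to begin with `T` and then exchange `x` for the third vertex.
    · have hQT : Q.erase x ⊆ T := fun y hy => by
        have hy' := Finset.mem_erase.1 hy
        exact (hadj y ((Finset.mem_insert.1 (hQS hy'.2)).resolve_left hy'.1)).1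
          (hQ.1 hxQ hy'.2 hy'.1.symm)
      have hcard : (Q.erase x).card = 2 := by rw [Finset.card_erase_of_mem hxQ, hQ.2]
      obtain ⟨c, hcT, hcQ⟩ := Finset.exists_mem_notMem_of_card_lt_card
        (show (Q.erase x).card < T.card by rw [hcard, hT.2]; omega)
      have heq : Q.erase x = T.erase c :=
        Finset.eq_of_subset_of_card_le
          (fun y hy => Finset.mem_erase.2 ⟨fun h => hcQ (h ▸ hy), hQT hy⟩)
          (by rw [hcard, Finset.card_erase_of_mem hcT, hT.2])
      rw [← Finset.insert_erase hxQ, heq]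
      exact insert_of_adj_base (ih hTS hT) hT hx hadj hcT
    · exact .step (ih (fun y hy => (Finset.mem_insert.1 (hQS hy)).resolve_left
        fun h => hxQ (h ▸ hy)) hQ) hx hTS hT hadj

/-- The stacking can begin with a triangle whose vertices have at most one common neighbour. -/
theorem exists_base_unique_common_neighbor [Fintype V] (hS : StackedFrom G T₀ Finset.univ)
    (hT₀ : G.IsNClique 3 T₀) : ∃ Q, G.IsNClique 3 Q ∧ StackedFrom G Q Finset.univ ∧
      ∀ y z, (∀ t ∈ Q, G.Adj y t) → (∀ t ∈ Q, G.Adj z t) → y = z := by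
  generalize hU : (Finset.univ : Finset V) = U at hS
  cases hS with
  | base =>
    refine ⟨T₀, hT₀, .base, fun y z hy => ?_⟩
    exact ((hy y (hU ▸ Finset.mem_univ y)).ne rfl).elim
  | @step S T x hS hx hTS hT hadj =>
    obtain ⟨c, hc⟩ := Finset.card_pos.1 (show 0 < T.card by rw [hT.2]; omega)
    have hxT : ∀ y, G.Adj x y ↔ y ∈ T := fun y => by
      rcases Finset.mem_insert.1 (hU ▸ Finset.mem_univ y) with rfl | hy
      · exact iff_of_false (fun h => h.ne rfl) fun h => hx (hTS h)
      · exact hadj y hy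
    have hQ : G.IsNClique 3 (insert x (T.erase c)) := by
      refine SimpleGraph.IsNClique.insert ⟨hT.1.subset (by simp), ?_⟩ fun y hy =>
        (hxT y).2 (Finset.mem_of_mem_erase hy)
      rw [Finset.card_erase_of_mem hc, hT.2]
    -- No vertex comes after `x`, so a common neighbour of the new base is adjacent to `x` and hence
    -- lies in `T`; only `c` is left.
    have key : ∀ y, (∀ t ∈ insert x (T.erase c), G.Adj y t) → y = c := fun y hy => by
      have h1 : y ∈ T := (hxT y).1 (hy x (Finset.mem_insert_self _ _)).symm
      by_contra hne
      exact (hy y (Finset.mem_insert_of_mem (Finset.mem_erase.2 ⟨hne, h1⟩))).ne rfl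
    exact ⟨_, hQ, (StackedFrom.step hS hx hTS hT hadj).rebase hT₀ (hU ▸ Finset.subset_univ _) hQ,
      fun y z hy hz => (key y hy).trans (key z hz).symm⟩

end StackedFrom

/-! ## Tree decompositions given by parent functions -/

/-- The graph on `0, …, n` in which each `i > 0` is joined to its parent `f i`. -/
def parentGraph (n : ℕ) (f : ℕ → ℕ) : SimpleGraph (Fin (n + 1)) where
  Adj i j := i ≠ j ∧ ((0 < (i : ℕ) ∧ (j : ℕ) = f i) ∨ (0 < (j : ℕ) ∧ (i : ℕ) = f j))
  symm := ⟨fun _ _ h => ⟨h.1.symm, h.2.symm⟩⟩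
  loopless := ⟨fun _ h => h.1 rfl⟩

/-- Following parents strictly decreases the index and stays in `A` until `r` is reached, so every
node of `A` is linked to `r`. -/
theorem parentGraph_induce_connected {n : ℕ} {f : ℕ → ℕ} (hf : ∀ i, 0 < i → f i < i)
    {A : Set (Fin (n + 1))} {r : Fin (n + 1)} (hr : r ∈ A)
    (hA : ∀ i ∈ A, i ≠ r → 0 < (i : ℕ) ∧ ∀ j : Fin (n + 1), (j : ℕ) = f i → j ∈ A) :
    ((parentGraph n f).induce A).Connected := by
  rw [SimpleGraph.connected_iff_exists_forall_reachable]
  refine ⟨⟨r, hr⟩, ?_⟩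
  have key : ∀ k : ℕ, ∀ i : Fin (n + 1), (i : ℕ) = k → ∀ hi : i ∈ A,
      ((parentGraph n f).induce A).Reachable ⟨r, hr⟩ ⟨i, hi⟩ := by
    intro k
    induction k using Nat.strong_induction_on with
    | _ k ih =>
      intro i hik hi
      by_cases hir : i = r
      · subst hir; exact .rfl
      · obtain ⟨hpos, hpar⟩ := hA i hi hir
        have hlt := hf i hpos
        have hj := hpar ⟨f i, hlt.trans i.2⟩ rfl
        refine (ih (f i) (hik ▸ hlt) ⟨f i, hlt.trans i.2⟩ rfl hj).trans
          (SimpleGraph.Adj.reachable ?_)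
        refine ⟨fun h => ?_, Or.inr ⟨hpos, rfl⟩⟩
        have := congrArg Fin.val h
        simp only [Function.Embedding.subtype_apply] at this
        omega
  rintro ⟨i, hi⟩
  exact key i i rfl hi

theorem parentGraph_isTree {n : ℕ} {f : ℕ → ℕ} (hf : ∀ i, 0 < i → f i < i) :
    (parentGraph n f).IsTree := by
  have hconn : (parentGraph n f).Connected := by
    rw [← (SimpleGraph.induceUnivIso (parentGraph n f)).connected_iff]
    exact parentGraph_induce_connected hf (r := 0) (Set.mem_univ _) fun i _ hi =>
      ⟨Nat.pos_of_ne_zero fun h => hi (Fin.ext h), fun _ _ => Set.mem_univ _⟩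
  rw [SimpleGraph.isTree_iff_connected_and_card]
  refine ⟨hconn, le_antisymm ?_ hconn.card_vert_le_card_edgeSet_add_one⟩
  let edge : Fin n → Sym2 (Fin (n + 1)) := fun i =>
    s(i.succ, ⟨f i.succ, (hf _ (by simp)).trans i.succ.2⟩)
  have aux : ∀ i j : Fin (n + 1), 0 < (i : ℕ) → (j : ℕ) = f i → s(i, j) ∈ Set.range edge := by
    intro i j hi hji
    obtain ⟨k, rfl⟩ := Fin.exists_succ_eq.2 (show i ≠ 0 from fun h => by simp [h] at hi)
    exact ⟨k, by simp only [edge, ← hji]⟩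
  have hsub : (parentGraph n f).edgeSet ⊆ Set.range edge := by
    intro e he
    induction e using Sym2.ind with
    | _ i j =>
      rcases he.2 with h | h
      · exact aux i j h.1 h.2
      · rw [Sym2.eq_swap]
        exact aux j i h.1 h.2
  have hcard : (parentGraph n f).edgeSet.ncard ≤ n := calc
    _ ≤ (Set.range edge).ncard := Set.ncard_le_ncard hsub (Set.toFinite _)
    _ ≤ (Set.univ : Set (Fin n)).ncard := by
      rw [← Set.image_univ]; exact Set.ncard_image_le (Set.toFinite _)
    _ = n := by simp [Set.ncard_univ]
  rw [Nat.card_coe_set_eq]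
  simpa using hcard

/-- A stacked graph has a tree decomposition with bags of at most four vertices. -/
theorem StackedFrom.exists_parent_bag {V : Type*} [DecidableEq V] {G : SimpleGraph V}
    {T₀ S : Finset V} (hS : StackedFrom G T₀ S) (hT₀ : T₀.card = 3) :
    ∃ (n : ℕ) (f : ℕ → ℕ) (bag : ℕ → Finset V), (∀ i, 0 < i → f i < i) ∧
      (∀ i, (bag i).card ≤ 4) ∧ (∀ i ≤ n, bag i ⊆ S) ∧
      (∀ K ⊆ S, G.IsClique (K : Set V) → ∃ i ≤ n, K ⊆ bag i) ∧
      ∀ v ∈ S, ∃ r ≤ n, v ∈ bag r ∧ ∀ i ≤ n, v ∈ bag i → i ≠ r → 0 < i ∧ v ∈ bag (f i) := by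
  induction hS with
  | base =>
    refine ⟨0, fun _ => 0, fun _ => T₀, fun i hi => hi, fun _ => by simp [hT₀], fun _ _ => subset_rfl,
      fun K hK _ => ⟨0, le_rfl, hK⟩, fun v hv => ⟨0, le_rfl, hv, fun i hi _ h => ?_⟩⟩
    exact (h (Nat.le_zero.1 hi)).elim
  | @step S T x hS hx hTS hT hadj ih =>
    obtain ⟨n, f, bag, hf, hcard, hbag, hclique, hroot⟩ := ih
    -- The new node gets the bag `insert x T` and is hung below a node `p` whose bag already
    -- contains `T`, so the nodes of each old vertex stay connected.
    obtain ⟨p, hp, hTp⟩ := hclique T hTS hT.1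
    have hold : ∀ i ≤ n, Function.update f (n + 1) p i = f i ∧
        Function.update bag (n + 1) (insert x T) i = bag i := fun i hi => by
      have : i ≠ n + 1 := by omega
      simp [this]
    have hbagf : ∀ i ≤ n, 0 < i →
        Function.update bag (n + 1) (insert x T) (f i) = bag (f i) := fun i hi h0 =>
      (hold _ ((hf i h0).le.trans hi)).2
    refine ⟨n + 1, Function.update f (n + 1) p, Function.update bag (n + 1) (insert x T),
      fun i hi => ?_, fun i => ?_, fun i hi => ?_, fun K hKS hK => ?_, fun v hv => ?_⟩
    · by_cases h : i = n + 1
      · subst h; simpa using Nat.lt_succ_of_le hp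
      · simpa [h] using hf i hi
    · by_cases h : i = n + 1
      · subst h
        simpa [hT.2] using Finset.card_insert_le x T
      · simpa [h] using hcard i
    · rcases Nat.le_succ_iff.1 hi with h | rfl
      · rw [(hold i h).2]
        exact (hbag i h).trans (Finset.subset_insert _ _)
      · simpa using Finset.insert_subset_insert x hTS
    · by_cases hxK : x ∈ K
      · refine ⟨n + 1, le_rfl, fun y hy => ?_⟩
        rw [Function.update_self]
        rcases Finset.mem_insert.1 (hKS hy) with rfl | hyS
        · exact Finset.mem_insert_self _ _
        · exact Finset.mem_insert_of_mem ((hadj y hyS).1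
            (hK hxK hy fun h => hx (h ▸ hyS)))
      · obtain ⟨i, hi, hKi⟩ := hclique K (fun y hy =>
          (Finset.mem_insert.1 (hKS hy)).resolve_left fun h => hxK (h ▸ hy)) hK
        exact ⟨i, by omega, by rwa [(hold i hi).2]⟩
    · rcases Finset.mem_insert.1 hv with rfl | hvS
      · refine ⟨n + 1, le_rfl, by simp, fun i hi hvi hne => ?_⟩
        have hi' : i ≤ n := by omega
        rw [(hold i hi').2] at hvi
        exact (hx (hbag i hi' hvi)).elim
      · obtain ⟨r, hr, hvr, hpar⟩ := hroot v hvS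
        refine ⟨r, by omega, by rwa [(hold r hr).2], fun i hi hvi hne => ?_⟩
        rcases Nat.le_succ_iff.1 hi with h | rfl
        · rw [(hold i h).2] at hvi
          obtain ⟨h0, h1⟩ := hpar i h hvi hne
          rw [(hold i h).1, hbagf i h h0]
          exact ⟨h0, h1⟩
        · rw [Function.update_self] at hvi
          have hvT := (Finset.mem_insert.1 hvi).resolve_left fun h => hx (h ▸ hvS)
          rw [Function.update_self, (hold p hp).2]
          exact ⟨by omega, hTp hvT⟩

theorem StackedFrom.exists_treeDecomposition {V : Type*} [Fintype V] [DecidableEq V]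
    {G : SimpleGraph V} {T₀ : Finset V} (hS : StackedFrom G T₀ Finset.univ) (hT₀ : T₀.card = 3) :
    ∃ D : TreeDecomposition G, ∀ i, (D.bag i).card ≤ 3 + 1 := by
  obtain ⟨n, f, bag, hf, hcard, -, hclique, hroot⟩ := hS.exists_parent_bag hT₀
  refine ⟨⟨n + 1, parentGraph n f, fun i => bag i, parentGraph_isTree hf, fun u v huv => ?_,
    fun v => ?_⟩, fun i => hcard i⟩
  · obtain ⟨i, hi, hsub⟩ := hclique {u, v} (Finset.subset_univ _)
      (by simpa [SimpleGraph.isClique_iff, Set.pairwise_pair, huv.symm] using fun _ => huv)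
    exact ⟨⟨i, by omega⟩, hsub (by simp), hsub (by simp)⟩
  · obtain ⟨r, hr, hvr, hpar⟩ := hroot v (Finset.mem_univ v)
    refine parentGraph_induce_connected hf (r := ⟨r, by omega⟩) hvr fun i hi hne => ?_
    obtain ⟨h0, h1⟩ := hpar i (by omega) hi fun h => hne (Fin.ext h)
    refine ⟨h0, fun j hj => ?_⟩
    rw [Set.mem_ofPred_eq, hj]
    exact h1

/-! ## Graphs of treewidth at most three -/

/-- In a tree, each node has a parent and a depth such that the edges join nodes to their parents. -/
theorem SimpleGraph.IsTree.exists_parent_depth {ι : Type*} {T : SimpleGraph ι} (hT : T.IsTree) :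
    ∃ (p : ι → ι) (depth : ι → ℕ), ∀ i j, T.Adj i j →
      (p i = j ∧ depth j < depth i) ∨ (p j = i ∧ depth i < depth j) := by
  obtain ⟨r⟩ := hT.1.nonempty
  choose w hw using fun i => hT.1.exists_walk_length_eq_dist i r
  -- Paths to the root are unique, so the chosen shortest walk from the farther end of an edge must
  -- start with that edge.
  have key : ∀ i j, T.Adj i j → T.dist r i = T.dist r j + 1 → (w i).snd = j := fun i j hij hd => by
    have hlen : (SimpleGraph.Walk.cons hij (w j)).length = T.dist i r := by
      rw [SimpleGraph.Walk.length_cons, hw, SimpleGraph.dist_comm, ← hd, SimpleGraph.dist_comm]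
    have heq := congrArg (fun q : T.Path i r => q.1.snd) ((hT.isAcyclic.subsingleton_path i r).elim
      ⟨w i, SimpleGraph.Walk.isPath_of_length_eq_dist _ (hw i)⟩
      ⟨_, SimpleGraph.Walk.isPath_of_length_eq_dist _ hlen⟩)
    simpa using heq
  refine ⟨fun i => (w i).snd, fun i => T.dist r i, fun i j hij => ?_⟩
  rcases hT.dist_eq_dist_add_one_of_adj r hij with h | h
  · exact Or.inl ⟨key i j hij h, by dsimp only; omega⟩
  · exact Or.inr ⟨key j i hij.symm h, by dsimp only; omega⟩

section Bags

variable {ι : Type*} {T : SimpleGraph ι} {p : ι → ι} {depth : ι → ℕ}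

/-- A node of a subtree whose parent is not in the subtree is the only highest one. -/
theorem eq_or_depth_lt_of_parent_notMem
    (hp : ∀ i j, T.Adj i j → (p i = j ∧ depth j < depth i) ∨ (p j = i ∧ depth i < depth j))
    {A : Set ι} (hA : (T.induce A).Preconnected) {i : ι} (hi : i ∈ A)
    (hpi : ¬ (p i ∈ A ∧ depth (p i) < depth i)) {j : ι} (hj : j ∈ A) :
    j = i ∨ depth i < depth j := by
  let Desc : ι → Prop := Relation.ReflTransGen (fun a b => p b = a ∧ depth a < depth b) i
  have hdesc : ∀ k, Desc k → k = i ∨ depth i < depth k := fun k hk => by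
    induction hk with
    | refl => exact Or.inl rfl
    | tail _ h ih => rcases ih with rfl | ih <;> right <;> omega
  refine hdesc j ?_
  obtain ⟨w⟩ := hA ⟨i, hi⟩ ⟨j, hj⟩
  have key : ∀ (a b : A) (w : (T.induce A).Walk a b), Desc a → Desc b := by
    intro a b w
    induction w with
    | nil => exact id
    | @cons a b _ hab _ ih =>
      intro ha
      apply ih
      have hab' : T.Adj a b := hab
      rcases hp _ _ hab' with h | h
      · rcases Relation.ReflTransGen.cases_tail ha with h' | ⟨c, hc, h'⟩
        · rw [h'] at h
          refine (hpi ⟨?_, ?_⟩).elim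
          · rw [h.1]; exact b.2
          · rw [h.1]; exact h.2
        · rw [← h.1, h'.1]
          exact hc
      · exact Relation.ReflTransGen.tail ha h
  exact key _ _ w .refl

/-- If the highest node `t u` of the subtree of `u` is at least as high as the highest node `t v` of
the subtree of `v` and the two subtrees meet, then `t v` belongs to the subtree of `u`. -/
theorem mem_top_of_mem
    (hp : ∀ i j, T.Adj i j → (p i = j ∧ depth j < depth i) ∨ (p j = i ∧ depth i < depth j))
    {A B : Set ι} (hA : (T.induce A).Preconnected) (hB : (T.induce B).Preconnected)
    {s t : ι} (hs : s ∈ A) (ht : t ∈ B) (htop : ∀ i ∈ B, depth t ≤ depth i)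
    (hst : depth s ≤ depth t) : ∀ i, i ∈ A → i ∈ B → t ∈ A := by
  suffices ∀ n i, depth i = n → i ∈ A → i ∈ B → t ∈ A from fun i => this _ i rfl
  intro n
  induction n using Nat.strong_induction_on with
  | _ n ih =>
    intro i hin hiA hiB
    -- From a common node one climbs inside `B`. Leaving `A` before reaching `t` would make `i` the
    -- top of `A` and strictly deeper than `t`, against `hst`.
    by_cases hpB : p i ∈ B ∧ depth (p i) < depth i
    · by_cases hpA : p i ∈ A ∧ depth (p i) < depth i
      · exact ih _ (hin ▸ hpB.2) _ rfl hpA.1 hpB.1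
      · have h1 := htop _ hpB.1
        rcases eq_or_depth_lt_of_parent_notMem hp hA hiA hpA hs with rfl | h <;> omega
    · rcases eq_or_depth_lt_of_parent_notMem hp hB hiB hpB ht with rfl | h
      · exact hiA
      · have := htop i hiB
        omega

/-- Given a tree decomposition with bags of at most four vertices, there is a stacked graph in which
all bags are cliques. -/
theorem exists_stackedFrom_of_bags {V : Type*} [DecidableEq V] [Finite ι] (hT : T.IsTree)
    (bag : ι → Finset V) (hcard : ∀ i, (bag i).card ≤ 4)
    (hconn : ∀ v, (T.induce {i | v ∈ bag i}).Connected) (S : Finset V) (hS : 3 ≤ S.card) :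
    ∃ (H : SimpleGraph V) (T₀ : Finset V), H.IsNClique 3 T₀ ∧ StackedFrom H T₀ S ∧
      ∀ i, H.IsClique ((bag i ∩ S : Finset V) : Set V) := by
  obtain ⟨p, depth, hp⟩ := hT.exists_parent_depth
  have htop : ∀ v, ∃ t, v ∈ bag t ∧ ∀ i, v ∈ bag i → depth t ≤ depth i := fun v => by
    obtain ⟨⟨i, hi⟩⟩ := (hconn v).nonempty
    exact Set.exists_min_image {i | v ∈ bag i} depth (Set.toFinite _) ⟨i, hi⟩
  choose t ht htmin using htop
  generalize hn : S.card = n at hS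
  induction n, hS using Nat.le_induction generalizing S with
  | base =>
    refine ⟨⊤, S, ⟨fun u _ v _ h => h, hn⟩, .base, fun i u _ v _ h => h⟩
  | succ n hn3 ih =>
    -- With `v` of deepest top, every other vertex of `S` that shares a bag with `v` lies in the bag
    -- at `t v` (`mem_top_of_mem`). There are at most three of them; they form a clique, and `v` is
    -- stacked on a triangle containing it.
    obtain ⟨v, hvS, hvmax⟩ := S.exists_max_image (fun v => depth (t v))
      (Finset.card_pos.1 (by omega))
    obtain ⟨H, T₀, hT₀, hstack, hclique⟩ := ih (S.erase v) (by
      rw [Finset.card_erase_of_mem hvS]; omega)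
    obtain ⟨U, hUS, hKU, hU⟩ := hstack.exists_triangle_superset hT₀
      (K := bag (t v) ∩ S.erase v) Finset.inter_subset_right (hclique _) (by
        have h1 : bag (t v) ∩ S.erase v ⊆ (bag (t v)).erase v := fun y hy => by
          simp only [Finset.mem_inter, Finset.mem_erase] at hy ⊢
          exact ⟨hy.2.1, hy.1⟩
        have h2 := Finset.card_le_card h1
        rw [Finset.card_erase_of_mem (ht v)] at h2
        have := hcard (t v)
        omega)
    have hvU : v ∉ U := fun h => Finset.notMem_erase v S (hUS h)
    let H' : SimpleGraph V :=
      { Adj := fun a b => (a ≠ v ∧ b ≠ v ∧ H.Adj a b) ∨ (a = v ∧ b ∈ U) ∨ (b = v ∧ a ∈ U)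
        symm := ⟨fun a b h => by
          rcases h with ⟨h1, h2, h3⟩ | h | h
          · exact Or.inl ⟨h2, h1, h3.symm⟩
          · exact Or.inr (Or.inr h)
          · exact Or.inr (Or.inl h)⟩
        loopless := ⟨fun a h => by
          rcases h with ⟨-, -, h⟩ | ⟨rfl, h⟩ | ⟨rfl, h⟩
          · exact h.ne rfl
          · exact hvU h
          · exact hvU h⟩ }
    have hagree : ∀ a ∈ S.erase v, ∀ b ∈ S.erase v, H.Adj a b ↔ H'.Adj a b := fun a ha b hb => by
      have ha' := Finset.ne_of_mem_erase ha
      have hb' := Finset.ne_of_mem_erase hb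
      simp [H', ha', hb']
    have hadjv : ∀ y, H'.Adj v y ↔ y ∈ U := fun y => by
      simp only [H', ne_eq, not_true_eq_false, false_and, true_and, false_or]
      exact or_iff_left fun h => hvU h.2
    have hstep := StackedFrom.step (hstack.of_adj_iff hagree) (Finset.notMem_erase v S) hUS
      (hU.of_adj_iff hUS hagree) fun y _ => hadjv y
    rw [Finset.insert_erase hvS] at hstep
    refine ⟨H', T₀, hT₀.of_adj_iff hstack.base_subset hagree, hstep, fun i a ha b hb hab => ?_⟩
    have hv : ∀ y, v ∈ bag i → y ∈ bag i → y ∈ S → y ≠ v → H'.Adj v y := fun y hvi hyi hyS hyv =>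
      (hadjv y).2 (hKU (Finset.mem_inter.2 ⟨mem_top_of_mem hp (hconn y).preconnected
        (hconn v).preconnected (ht y) (ht v) (htmin v) (hvmax y hyS) i hyi hvi,
          Finset.mem_erase.2 ⟨hyv, hyS⟩⟩))
    simp only [Finset.coe_inter, Set.mem_inter_iff, Finset.mem_coe] at ha hb
    by_cases hav : a = v
    · subst hav
      exact hv b ha.1 hb.1 hb.2 hab.symm
    · by_cases hbv : b = v
      · subst hbv
        exact (hv a hb.1 ha.1 ha.2 hab).symm
      · have ha' := Finset.mem_erase.2 ⟨hav, ha.2⟩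
        have hb' := Finset.mem_erase.2 ⟨hbv, hb.2⟩
        exact (hagree a ha' b hb').1 (hclique i (by simp [ha.1, ha.2, hav])
          (by simp [hb.1, hb.2, hbv]) hab)

end Bags

theorem graphTreewidth_le {V : Type*} {G : SimpleGraph V} {k : ℕ} (D : TreeDecomposition G)
    (hD : ∀ i, (D.bag i).card ≤ k + 1) : graphTreewidth G ≤ k :=
  Nat.sInf_le ⟨D, hD⟩

/-- The tree decomposition with one bag. -/
def trivialTreeDecomposition {V : Type*} [Fintype V] (G : SimpleGraph V) :
    TreeDecomposition G where
  size := 1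
  tree := ⊥
  bag := fun _ => Finset.univ
  isTree := .of_subsingleton
  edge_covered := fun u v _ => ⟨0, Finset.mem_univ u, Finset.mem_univ v⟩
  connected := fun v => by
    have : Nonempty {i : Fin 1 | v ∈ (Finset.univ : Finset V)} := ⟨⟨0, Finset.mem_univ v⟩⟩
    exact SimpleGraph.IsTree.of_subsingleton.1

theorem exists_treeDecomposition_graphTreewidth {V : Type*} [Fintype V] (G : SimpleGraph V) :
    ∃ D : TreeDecomposition G, ∀ i, (D.bag i).card ≤ graphTreewidth G + 1 :=
  Nat.sInf_mem (s := {k : ℕ | ∃ D : TreeDecomposition G, ∀ i, (D.bag i).card ≤ k + 1})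
    ⟨Fintype.card V, trivialTreeDecomposition G, fun _ => Nat.le_succ _⟩

theorem graphTreewidth_mono {V : Type*} [Fintype V] {G H : SimpleGraph V} (hGH : G ≤ H) :
    graphTreewidth G ≤ graphTreewidth H := by
  obtain ⟨D, hD⟩ := exists_treeDecomposition_graphTreewidth H
  exact graphTreewidth_le ⟨D.size, D.tree, D.bag, D.isTree,
    fun u v h => D.edge_covered u v (hGH h), D.connected⟩ hD

/-- Every `3`-tree is a stacked graph. -/
theorem IsKTree.exists_stackedFrom {V : Type*} [Fintype V] [DecidableEq V] {G : SimpleGraph V}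
    (hG : IsKTree 3 G) :
    ∃ T₀, G.IsNClique 3 T₀ ∧ StackedFrom G T₀ Finset.univ := by
  have htw : graphTreewidth G = 3 := hG.1
  have hV : 3 ≤ (Finset.univ : Finset V).card := by
    by_contra h
    have := graphTreewidth_le (k := 2) (trivialTreeDecomposition G) fun _ => by
      simp only [trivialTreeDecomposition]; omega
    omega
  obtain ⟨D, hD⟩ := exists_treeDecomposition_graphTreewidth G
  rw [htw] at hD
  obtain ⟨H, T₀, hT₀, hH, hclique⟩ :=
    exists_stackedFrom_of_bags D.isTree D.bag hD D.connected Finset.univ hV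
  have hGH : G ≤ H := fun u v huv => by
    obtain ⟨i, hu, hv⟩ := D.edge_covered u v huv
    exact hclique i (by simpa using hu) (by simpa using hv) huv.ne
  -- The stacked supergraph `H` again has treewidth 3, so maximality of `G` forces `G = H`.
  obtain ⟨D', hD'⟩ := hH.exists_treeDecomposition hT₀.2
  have hH3 : graphTreewidth H = 3 :=
    le_antisymm (graphTreewidth_le D' hD') (htw ▸ graphTreewidth_mono hGH)
  rw [le_antisymm hGH (hG.2 hH3 hGH)]
  exact ⟨T₀, hT₀, hH⟩

/-! ## Private regions -/

theorem LShape.mem_toSet {P : LShape} {z : ℝ × ℝ} : z ∈ P.toSet ↔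
    (z.1 = P.corner.1 ∧ P.corner.2 ≤ z.2 ∧ z.2 ≤ P.corner.2 + P.height) ∨
      (P.corner.1 ≤ z.1 ∧ z.1 ≤ P.corner.1 + P.width ∧ z.2 = P.corner.2) := by
  simp [LShape.toSet, Set.mem_prod, and_assoc]

/-- The mirror image of an L-shape in the diagonal. -/
def LShape.swap (P : LShape) : LShape :=
  ⟨P.corner.swap, P.width, P.height, P.width_pos, P.height_pos⟩

theorem LShape.toSet_swap (P : LShape) : P.swap.toSet = Prod.swap ⁻¹' P.toSet := by
  ext z
  simp only [LShape.mem_toSet, LShape.swap, Set.mem_preimage, Prod.fst_swap, Prod.snd_swap]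
  tauto

/-- The L-shape with corner `(x, y)` that reaches up to height `y'` and right to abscissa `x'`. -/
def LShape.ofTips {x y x' y' : ℝ} (hx : x < x') (hy : y < y') : LShape :=
  ⟨(x, y), y' - y, x' - x, sub_pos.2 hy, sub_pos.2 hx⟩

theorem LShape.mem_ofTips {x y x' y' : ℝ} (hx : x < x') (hy : y < y') {z : ℝ × ℝ} :
    z ∈ (LShape.ofTips hx hy).toSet ↔
      (z.1 = x ∧ y ≤ z.2 ∧ z.2 ≤ y') ∨ (x ≤ z.1 ∧ z.1 ≤ x' ∧ z.2 = y) := by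
  simp [LShape.mem_toSet, LShape.ofTips]

/-- A horizontal bar `[a, b] × [c, d]` with two vertical teeth, `[a, a'] × [c, e]` and
`[p, q] × [c, e]`. -/
def combSet (a a' p q b c d e : ℝ) : Set (ℝ × ℝ) :=
  {z | (a ≤ z.1 ∧ z.1 ≤ b ∧ c ≤ z.2 ∧ z.2 ≤ d) ∨ (a ≤ z.1 ∧ z.1 ≤ a' ∧ c ≤ z.2 ∧ z.2 ≤ e) ∨
    (p ≤ z.1 ∧ z.1 ≤ q ∧ c ≤ z.2 ∧ z.2 ≤ e)}

theorem mem_combSet {a a' p q b c d e : ℝ} {z : ℝ × ℝ} : z ∈ combSet a a' p q b c d e ↔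
    (a ≤ z.1 ∧ z.1 ≤ b ∧ c ≤ z.2 ∧ z.2 ≤ d) ∨ (a ≤ z.1 ∧ z.1 ≤ a' ∧ c ≤ z.2 ∧ z.2 ≤ e) ∨
      (p ≤ z.1 ∧ z.1 ≤ q ∧ c ≤ z.2 ∧ z.2 ≤ e) := Iff.rfl

/-- The set `R` is a comb that `U` and `W` cross as vertical lines and `V` crosses as a horizontal
line: `U` crosses the bar between the two teeth, `W` to the right of the teeth, and `V` crosses both
teeth above the bar. -/
def IsComb (R U V W : Set (ℝ × ℝ)) : Prop :=
  ∃ a a' X p q X' b c d Y e : ℝ, (a < a' ∧ a' < X ∧ X < p ∧ p < q ∧ q < X' ∧ X' < b) ∧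
    (c < d ∧ d < Y ∧ Y < e) ∧ R = combSet a a' p q b c d e ∧
      ∀ z ∈ R, (z ∈ U ↔ z.1 = X) ∧ (z ∈ V ↔ z.2 = Y) ∧ (z ∈ W ↔ z.1 = X')

/-- Into a comb one can insert an L-shape that meets the three given sets, such that three disjoint
combs remain, each for the L-shape and two of the given sets and away from the third one; one of the combs is a mirror image. -/
theorem IsComb.exists_insert {R U V W : Set (ℝ × ℝ)} (h : IsComb R U V W) :
    ∃ (P : LShape) (R₁ R₂ R₃ : Set (ℝ × ℝ)), P.toSet ⊆ R ∧ (P.toSet ∩ U).Nonempty ∧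
      (P.toSet ∩ V).Nonempty ∧ (P.toSet ∩ W).Nonempty ∧ R₁ ⊆ R ∧ R₂ ⊆ R ∧ R₃ ⊆ R ∧
      Disjoint R₁ R₂ ∧ Disjoint R₁ R₃ ∧ Disjoint R₂ R₃ ∧
      Disjoint W R₁ ∧ Disjoint V R₂ ∧ Disjoint U R₃ ∧ IsComb R₁ P.toSet V U ∧
      IsComb R₂ U P.toSet W ∧
      IsComb (Prod.swap ⁻¹' R₃) (Prod.swap ⁻¹' P.toSet) (Prod.swap ⁻¹' W) (Prod.swap ⁻¹' V) := by
  obtain ⟨a, a', X, p, q, X', b, c, d, Y, e, ⟨h1, h2, h3, h4, h5, h6⟩, ⟨h7, h8, h9⟩, rfl, hz⟩ := h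
  -- The corner `(x, y)` of the new L lies where the left tooth meets the bar. Its vertical arm runs
  -- up the left tooth across `V`; its horizontal arm runs along the bar across `U` and `W`.
  obtain ⟨x, hax, hxa⟩ := exists_between h1
  obtain ⟨y, hcy, hyd⟩ := exists_between h7
  obtain ⟨a₁, ha₁, ha₁'⟩ := exists_between hax
  obtain ⟨p₁, hp₁, hp₁'⟩ := exists_between hxa
  obtain ⟨q₁, hq₁, hq₁'⟩ := exists_between hp₁'
  obtain ⟨b₁, hb₁, hb₁'⟩ := exists_between h3
  obtain ⟨c₁, hc₁, hc₁'⟩ := exists_between hyd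
  obtain ⟨e₂, he₂, he₂'⟩ := exists_between hc₁
  obtain ⟨d₂, hd₂, hd₂'⟩ := exists_between hcy
  obtain ⟨m, hm, hm'⟩ := exists_between h4
  obtain ⟨q₂, hq₂, hq₂'⟩ := exists_between hm
  obtain ⟨a₃, ha₃, ha₃'⟩ := exists_between hd₂'
  obtain ⟨b₃, hb₃, hb₃'⟩ := exists_between ha₃'
  obtain ⟨p₃, hp₃, hp₃'⟩ := exists_between hyd
  have hxb : x < b := by linarith
  have hye : y < e := by linarith
  have hR : ∀ z ∈ combSet a a' p q b c d e,
    (z ∈ U ↔ z.1 = X) ∧ (z ∈ V ↔ z.2 = Y) ∧ (z ∈ W ↔ z.1 = X') := hz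
  have s₁ : combSet a a₁ p₁ q₁ b₁ c₁ d e ⊆ combSet a a' p q b c d e := by
    rintro ⟨z, w⟩ hz
    simp only [mem_combSet] at hz ⊢
    grind
  have s₂ : combSet p₁ q₁ p q₂ b c d₂ e₂ ⊆ combSet a a' p q b c d e := by
    rintro ⟨z, w⟩ hz
    simp only [mem_combSet] at hz ⊢
    grind
  have s₃ : Prod.swap ⁻¹' combSet a₃ b₃ p₃ d e m q b ⊆ combSet a a' p q b c d e := by
    rintro ⟨z, w⟩ hz
    simp only [mem_combSet, Set.mem_preimage, Prod.swap] at hz ⊢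
    grind
  -- `R₁` has its bar above the horizontal arm, ending before `p`, and its teeth on both sides of
  -- the vertical arm. `R₂` has its bar below the horizontal arm, and its teeth cross that arm but
  -- stop below `V`. `R₃` has its bar upright in the right tooth, and its teeth run to the right,
  -- below and above the horizontal arm.
  refine ⟨.ofTips hxb hye, combSet a a₁ p₁ q₁ b₁ c₁ d e, combSet p₁ q₁ p q₂ b c d₂ e₂,
    Prod.swap ⁻¹' combSet a₃ b₃ p₃ d e m q b, ?_, ⟨(X, y), ?_, ?_⟩, ⟨(x, Y), ?_, ?_⟩,
    ⟨(X', y), ?_, ?_⟩, s₁, s₂, s₃, ?_, ?_, ?_, ?_, ?_, ?_, ?_, ?_, ?_⟩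
  · rintro ⟨z, w⟩ hz
    simp only [mem_combSet, LShape.mem_ofTips] at hz ⊢
    grind
  · rw [LShape.mem_ofTips]; grind
  · exact (hR (X, y) (by rw [mem_combSet]; grind)).1.2 rfl
  · rw [LShape.mem_ofTips]; grind
  · exact (hR (x, Y) (by rw [mem_combSet]; grind)).2.1.2 rfl
  · rw [LShape.mem_ofTips]; grind
  · exact (hR (X', y) (by rw [mem_combSet]; grind)).2.2.2 rfl
  · rw [Set.disjoint_left]
    rintro ⟨z, w⟩ hz hz'
    simp only [mem_combSet] at hz hz'
    grind
  · rw [Set.disjoint_left]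
    rintro ⟨z, w⟩ hz hz'
    simp only [mem_combSet, Set.mem_preimage, Prod.swap] at hz hz'
    grind
  · rw [Set.disjoint_left]
    rintro ⟨z, w⟩ hz hz'
    simp only [mem_combSet, Set.mem_preimage, Prod.swap] at hz hz'
    grind
  · rw [Set.disjoint_right]
    intro z hz hzW
    have := (hR z (s₁ hz)).2.2.1 hzW
    rw [mem_combSet] at hz
    grind
  · rw [Set.disjoint_right]
    intro z hz hzV
    have := (hR z (s₂ hz)).2.1.1 hzV
    rw [mem_combSet] at hz
    grind
  · rw [Set.disjoint_right]
    intro z hz hzU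
    have := (hR z (s₃ hz)).1.1 hzU
    simp only [mem_combSet, Set.mem_preimage, Prod.swap] at hz
    grind
  · refine ⟨a, a₁, x, p₁, q₁, X, b₁, c₁, d, Y, e, by grind, by grind, rfl, fun z hz =>
      ⟨?_, (hR z (s₁ hz)).2.1, (hR z (s₁ hz)).1⟩⟩
    rw [LShape.mem_ofTips]
    rw [mem_combSet] at hz
    grind
  · refine ⟨p₁, q₁, X, p, q₂, X', b, c, d₂, y, e₂, by grind, by grind, rfl, fun z hz =>
      ⟨(hR z (s₂ hz)).1, ?_, (hR z (s₂ hz)).2.2⟩⟩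
    rw [LShape.mem_ofTips]
    rw [mem_combSet] at hz
    grind
  · refine ⟨a₃, b₃, y, p₃, d, Y, e, m, q, X', b, by grind, by grind, rfl, fun z hz =>
      ⟨?_, (hR z.swap (s₃ hz)).2.2, (hR z.swap (s₃ hz)).2.1⟩⟩
    rw [Set.mem_preimage, LShape.mem_ofTips]
    simp only [mem_combSet, Set.mem_preimage, Prod.swap] at hz ⊢
    grind

/-- A comb or the mirror image of a comb. -/
def IsPrivateRegion (R U V W : Set (ℝ × ℝ)) : Prop :=
  IsComb R U V W ∨
    IsComb (Prod.swap ⁻¹' R) (Prod.swap ⁻¹' U) (Prod.swap ⁻¹' V) (Prod.swap ⁻¹' W)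

theorem IsPrivateRegion.exists_insert {R U V W : Set (ℝ × ℝ)} (h : IsPrivateRegion R U V W) :
    ∃ (P : LShape) (R₁ R₂ R₃ : Set (ℝ × ℝ)), P.toSet ⊆ R ∧ (P.toSet ∩ U).Nonempty ∧
      (P.toSet ∩ V).Nonempty ∧ (P.toSet ∩ W).Nonempty ∧ R₁ ⊆ R ∧ R₂ ⊆ R ∧ R₃ ⊆ R ∧
      Disjoint R₁ R₂ ∧ Disjoint R₁ R₃ ∧ Disjoint R₂ R₃ ∧
      Disjoint W R₁ ∧ Disjoint V R₂ ∧ Disjoint U R₃ ∧ IsPrivateRegion R₁ P.toSet V U ∧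
      IsPrivateRegion R₂ U P.toSet W ∧ IsPrivateRegion R₃ P.toSet W V := by
  rcases h with h | h
  · obtain ⟨P, R₁, R₂, R₃, hP, hU, hV, hW, h1, h2, h3, h12, h13, h23, g1, g2, g3, k1, k2, k3⟩ :=
      h.exists_insert
    exact ⟨P, R₁, R₂, R₃, hP, hU, hV, hW, h1, h2, h3, h12, h13, h23, g1, g2, g3, .inl k1, .inl k2, .inr k3⟩
  · obtain ⟨P, R₁, R₂, R₃, hP, hU, hV, hW, h1, h2, h3, h12, h13, h23, g1, g2, g3, k1, k2, k3⟩ :=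
      h.exists_insert
    have swap_swap : ∀ A : Set (ℝ × ℝ), Prod.swap ⁻¹' (Prod.swap ⁻¹' A) = A := fun A => by
      rw [← Set.preimage_comp, Prod.swap_swap_eq, Set.preimage_id]
    have sub : ∀ {A B : Set (ℝ × ℝ)}, A ⊆ Prod.swap ⁻¹' B → Prod.swap ⁻¹' A ⊆ B := fun h => by
      simpa only [swap_swap] using Set.preimage_mono (f := Prod.swap) h
    have dis : ∀ {A B : Set (ℝ × ℝ)}, Disjoint (Prod.swap ⁻¹' A) B →
        Disjoint A (Prod.swap ⁻¹' B) := fun h => by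
      simpa only [swap_swap] using h.preimage Prod.swap
    have meet : ∀ {A : Set (ℝ × ℝ)}, (P.toSet ∩ Prod.swap ⁻¹' A).Nonempty →
        (P.swap.toSet ∩ A).Nonempty := fun {A} ⟨z, hz, hz'⟩ =>
      ⟨z.swap, by rw [P.toSet_swap]; simpa using hz, hz'⟩
    refine ⟨P.swap, Prod.swap ⁻¹' R₁, Prod.swap ⁻¹' R₂, Prod.swap ⁻¹' R₃, ?_, meet hU, meet hV,
      meet hW, sub h1, sub h2, sub h3, h12.preimage _, h13.preimage _, h23.preimage _, dis g1,
      dis g2, dis g3, .inr ?_, .inr ?_, .inl ?_⟩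
    · rw [P.toSet_swap]; exact sub hP
    · simpa only [P.toSet_swap, swap_swap] using k1
    · simpa only [P.toSet_swap, swap_swap] using k2
    · simpa only [P.toSet_swap, swap_swap] using k3

/-- There are three pairwise intersecting L-shapes with a private region. -/
theorem exists_initial_isPrivateRegion : ∃ (P Q S : LShape) (R : Set (ℝ × ℝ)),
    (P.toSet ∩ Q.toSet).Nonempty ∧ (P.toSet ∩ S.toSet).Nonempty ∧ (Q.toSet ∩ S.toSet).Nonempty ∧
      IsPrivateRegion R P.toSet Q.toSet S.toSet := by
  -- The comb lies above the horizontal arms of the first and third shapes (heights 0 and -1) and to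
  -- the right of the vertical arm of the second (abscissa 0), so it sees only the lines at
  -- abscissae 2 and 5 and at height 5.
  refine ⟨.ofTips (x := 2) (y := 0) (x' := 10) (y' := 10) (by norm_num) (by norm_num),
    .ofTips (x := 0) (y := 5) (x' := 10) (y' := 6) (by norm_num) (by norm_num),
    .ofTips (x := 5) (y := -1) (x' := 6) (y' := 10) (by norm_num) (by norm_num),
    combSet 1 (3/2) 3 4 6 1 2 6, ⟨(2, 5), ?_, ?_⟩, ⟨(5, 0), ?_, ?_⟩, ⟨(5, 5), ?_, ?_⟩,
    .inl ⟨1, 3/2, 2, 3, 4, 5, 6, 1, 2, 5, 6, by norm_num, by norm_num, rfl, fun z hz => ?_⟩⟩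
  iterate 6 (rw [LShape.mem_ofTips]; norm_num)
  simp only [mem_combSet, LShape.mem_ofTips] at hz ⊢
  refine ⟨?_, ?_, ?_⟩ <;> grind

/-! ## Representing planar `3`-trees -/

/-- The L-shapes `P` represent the graph that `G` induces on `S`, and `𝓡` is a set of pairwise
disjoint private regions, labelled with triangles of `G`. A triangle without a private region has
two common neighbours in `S`, or is `T₀` and has one. -/
structure IsLayout {V : Type*} [DecidableEq V] (G : SimpleGraph V) (T₀ S : Finset V)
    (P : V → LShape) (𝓡 : Set (Finset V × Set (ℝ × ℝ))) : Prop where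
  adj_iff : ∀ u ∈ S, ∀ v ∈ S, u ≠ v → (G.Adj u v ↔ ((P u).toSet ∩ (P v).toSet).Nonempty)
  subset : ∀ r ∈ 𝓡, r.1 ⊆ S
  region : ∀ r ∈ 𝓡, ∃ u v w, r.1 = {u, v, w} ∧
    IsPrivateRegion r.2 (P u).toSet (P v).toSet (P w).toSet
  avoid : ∀ r ∈ 𝓡, ∀ y ∈ S, y ∉ r.1 → Disjoint (P y).toSet r.2
  disjoint : 𝓡.Pairwise fun r r' => Disjoint r.2 r'.2
  apex : ∀ r ∈ 𝓡, r.1 = T₀ ∨ ∃ y ∈ S, ∀ t ∈ r.1, G.Adj y t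
  cover : ∀ T ⊆ S, G.IsNClique 3 T → (∃ R, (T, R) ∈ 𝓡) ∨ (T = T₀ ∧ ∃ y ∈ S, ∀ t ∈ T, G.Adj y t) ∨
    ∃ y ∈ S, ∃ z ∈ S, y ≠ z ∧ ∀ t ∈ T, G.Adj y t ∧ G.Adj z t

section Layout

variable {V : Type*} [DecidableEq V] {G : SimpleGraph V} {T₀ S T : Finset V} {P : V → LShape}
  {𝓡 : Set (Finset V × Set (ℝ × ℝ))} {R : Set (ℝ × ℝ)}

/-- A triangle has a layout. -/
theorem exists_isLayout_triangle (hT : G.IsNClique 3 T) : ∃ P 𝓡, IsLayout G T T P 𝓡 := by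
  obtain ⟨u, v, w, huv, huw, hvw, rfl⟩ := SimpleGraph.is3Clique_iff.1 hT
  obtain ⟨A, B, C, R, hAB, hAC, hBC, hR⟩ := exists_initial_isPrivateRegion
  let P : V → LShape := fun y => if y = u then A else if y = v then B else C
  have hu : P u = A := by simp [P]
  have hv : P v = B := by simp [P, huv.ne']
  have hw : P w = C := by simp [P, huw.ne', hvw.ne']
  have comm : ∀ {X Y : LShape}, (X.toSet ∩ Y.toSet).Nonempty → (Y.toSet ∩ X.toSet).Nonempty :=
    fun h => by rwa [Set.inter_comm]
  refine ⟨P, {({u, v, w}, R)}, ⟨fun a ha b hb hab => iff_of_true (hT.1 ha hb hab) ?_, ?_, ?_, ?_, ?_,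
    ?_, ?_⟩⟩
  · simp only [Finset.mem_insert, Finset.mem_singleton] at ha hb
    rcases ha with rfl | rfl | rfl <;> rcases hb with rfl | rfl | rfl <;>
      first
      | exact (hab rfl).elim
      | (simp only [hu, hv, hw]
         first
         | assumption
         | (apply comm; assumption))
  · rintro r rfl
    exact subset_rfl
  · rintro r rfl
    exact ⟨u, v, w, rfl, by rwa [hu, hv, hw]⟩
  · rintro r rfl y hy hy'
    exact (hy' hy).elim
  · exact Set.pairwise_singleton _ _
  · rintro r rfl
    exact Or.inl rfl
  · intro T hTS hT'
    refine Or.inl ⟨R, ?_⟩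
    rw [Finset.eq_of_subset_of_card_le hTS (by rw [hT'.2, hT.2])]
    rfl

/-- Stacking a vertex on a triangle with a private region. -/
theorem IsLayout.exists_insert (h : IsLayout G T₀ S P 𝓡) {x : V} (hx : x ∉ S) (hTS : T ⊆ S)
    (hT : G.IsNClique 3 T) (hadj : ∀ y ∈ S, G.Adj x y ↔ y ∈ T) (hR : (T, R) ∈ 𝓡) :
    ∃ P 𝓡, IsLayout G T₀ (insert x S) P 𝓡 := by
  obtain ⟨u, v, w, hTeq, hreg⟩ := h.region _ hR
  dsimp only at hTeq hreg
  subst hTeq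
  obtain ⟨L, R₁, R₂, R₃, hL, hLu, hLv, hLw, h1, h2, h3, h12, h13, h23, g1, g2, g3, k1, k2, k3⟩ :=
    hreg.exists_insert
  have huS : u ∈ S := hTS (by simp)
  have hvS : v ∈ S := hTS (by simp)
  have hwS : w ∈ S := hTS (by simp)
  have hxu : G.Adj x u := (hadj u huS).2 (by simp)
  have hxv : G.Adj x v := (hadj v hvS).2 (by simp)
  have hxw : G.Adj x w := (hadj w hwS).2 (by simp)
  obtain ⟨huv, huw, hvw⟩ : G.Adj u v ∧ G.Adj u w ∧ G.Adj v w := SimpleGraph.is3Clique_triple_iff.1 hT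
  let P' : V → LShape := Function.update P x L
  have hP'x : P' x = L := Function.update_self ..
  have hP' : ∀ y ∈ S, P' y = P y := fun y hy =>
    Function.update_of_ne (ne_of_mem_of_not_mem hy hx) ..
  have hsub : ∀ r ∈ 𝓡 \ {(({u, v, w} : Finset V), R)}, Disjoint R r.2 := fun r hr =>
    h.disjoint hR hr.1 fun h => hr.2 h.symm
  have hmeet : ∀ y ∈ S, G.Adj x y ↔ (L.toSet ∩ (P y).toSet).Nonempty := fun y hy => by
    rw [hadj y hy]
    by_cases hyT : y ∈ ({u, v, w} : Finset V)
    · refine iff_of_true hyT ?_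
      simp only [Finset.mem_insert, Finset.mem_singleton] at hyT
      rcases hyT with rfl | rfl | rfl <;> assumption
    · refine iff_of_false hyT ?_
      rw [Set.not_nonempty_iff_eq_empty, ← Set.disjoint_iff_inter_eq_empty]
      exact ((h.avoid _ hR y hy hyT).mono_right hL).symm
  refine ⟨P', insert ({x, v, u}, R₁) (insert ({u, x, w}, R₂) (insert ({x, w, v}, R₃)
    (𝓡 \ {({u, v, w}, R)}))), ⟨?_, ?_, ?_, ?_, ?_, ?_, ?_⟩⟩
  · intro a ha b hb hab
    rcases Finset.mem_insert.1 ha with rfl | haS <;> rcases Finset.mem_insert.1 hb with rfl | hbS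
    · exact (hab rfl).elim
    · rw [hP'x, hP' b hbS, hmeet b hbS]
    · rw [hP'x, hP' a haS, Set.inter_comm, G.adj_comm, hmeet a haS]
    · rw [hP' a haS, hP' b hbS, h.adj_iff a haS b hbS hab]
  · rintro r (rfl | rfl | rfl | hr)
    · simp [Finset.insert_subset_iff, huS, hvS]
    · simp [Finset.insert_subset_iff, huS, hwS]
    · simp [Finset.insert_subset_iff, hvS, hwS]
    · exact (h.subset r hr.1).trans (Finset.subset_insert _ _)
  · rintro r (rfl | rfl | rfl | hr)
    · exact ⟨x, v, u, rfl, by rwa [hP'x, hP' v hvS, hP' u huS]⟩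
    · exact ⟨u, x, w, rfl, by rwa [hP'x, hP' u huS, hP' w hwS]⟩
    · exact ⟨x, w, v, rfl, by rwa [hP'x, hP' w hwS, hP' v hvS]⟩
    · obtain ⟨a, b, c, habc, hreg⟩ := h.region r hr.1
      have hmem : ∀ y ∈ ({a, b, c} : Finset V), P' y = P y := fun y hy =>
        hP' y (h.subset r hr.1 (habc ▸ hy))
      exact ⟨a, b, c, habc, by rwa [hmem a (by simp), hmem b (by simp), hmem c (by simp)]⟩
  · have hrest : ∀ y ∈ S, y ∉ ({u, v, w} : Finset V) → ∀ R' ⊆ R, Disjoint (P y).toSet R' :=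
      fun y hy hyT R' hR' => (h.avoid _ hR y hy hyT).mono_right hR'
    rintro r (rfl | rfl | rfl | hr) y hy hyr
    · simp only [Finset.mem_insert, Finset.mem_singleton, not_or] at hyr hy
      have hyS := hy.resolve_left hyr.1
      rw [hP' y hyS]
      by_cases hyw : y = w
      · rwa [hyw]
      · exact hrest y hyS (by simp [hyr, hyw]) _ h1
    · simp only [Finset.mem_insert, Finset.mem_singleton, not_or] at hyr hy
      have hyS := hy.resolve_left hyr.2.1
      rw [hP' y hyS]
      by_cases hyv : y = v
      · rwa [hyv]
      · exact hrest y hyS (by simp [hyr, hyv]) _ h2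
    · simp only [Finset.mem_insert, Finset.mem_singleton, not_or] at hyr hy
      have hyS := hy.resolve_left hyr.1
      rw [hP' y hyS]
      by_cases hyu : y = u
      · rwa [hyu]
      · exact hrest y hyS (by simp [hyr, hyu]) _ h3
    · rcases Finset.mem_insert.1 hy with rfl | hyS
      · rw [hP'x]
        exact (hsub r hr).mono_left hL
      · rw [hP' y hyS]
        exact h.avoid r hr.1 y hyS hyr
  · have : Std.Symm fun r r' : Finset V × Set (ℝ × ℝ) => Disjoint r.2 r'.2 :=
      ⟨fun _ _ h => h.symm⟩
    refine (((h.disjoint.mono Set.sdiff_subset).insert_of_symm ?_).insert_of_symm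
      ?_).insert_of_symm ?_
    · intro r hr _
      exact (hsub r hr).mono_left h3
    · rintro r (rfl | hr) _
      · exact h23
      · exact (hsub r hr).mono_left h2
    · rintro r (rfl | rfl | hr) _
      · exact h12
      · exact h13
      · exact (hsub r hr).mono_left h1
  · rintro r (rfl | rfl | rfl | hr)
    -- The vertex of the old triangle that the new one omits is adjacent to all three vertices of
    -- the new one.
    · exact Or.inr ⟨w, by simp [hwS], by simp [hxw.symm, hvw.symm, huw.symm]⟩
    · exact Or.inr ⟨v, by simp [hvS], by simp [hxv.symm, hvw, huv.symm]⟩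
    · exact Or.inr ⟨u, by simp [huS], by simp [hxu.symm, huv, huw]⟩
    · exact (h.apex r hr.1).imp_right fun ⟨y, hy, hyr⟩ => ⟨y, Finset.mem_insert_of_mem hy, hyr⟩
  · intro U hUS hU
    by_cases hxU : x ∈ U
    · left
      have hsubT : U.erase x ⊆ {u, v, w} := fun y hy => by
        have hy' := Finset.mem_erase.1 hy
        exact (hadj y ((Finset.mem_insert.1 (hUS hy'.2)).resolve_left hy'.1)).1
          (hU.1 hxU hy'.2 hy'.1.symm)
      have hcard : (U.erase x).card = 2 := by rw [Finset.card_erase_of_mem hxU, hU.2]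
      have key : ∀ a b c, ({a, b, c} : Finset V) = {u, v, w} → a ∉ U.erase x → U = {x, b, c} := by
        intro a b c habc ha
        rw [← Finset.insert_erase hxU]
        congr 1
        refine Finset.eq_of_subset_of_card_le (fun y hy => ?_) (hcard ▸ Finset.card_le_two)
        have := habc ▸ hsubT hy
        exact (Finset.mem_insert.1 this).resolve_left fun h => ha (h ▸ hy)
      obtain ⟨c, hcT, hcU⟩ := Finset.exists_mem_notMem_of_card_lt_card
        (show (U.erase x).card < ({u, v, w} : Finset V).card by rw [hcard, hT.2]; omega)
      simp only [Finset.mem_insert, Finset.mem_singleton] at hcT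
      rcases hcT with rfl | rfl | rfl
      · refine ⟨R₃, Or.inr (Or.inr (Or.inl ?_))⟩
        rw [key c w v (by grind) hcU]
      · refine ⟨R₂, Or.inr (Or.inl ?_)⟩
        rw [key c u w (by grind) hcU, Finset.insert_comm]
      · refine ⟨R₁, Or.inl ?_⟩
        rw [key c v u (by grind) hcU]
    · have hUS' : U ⊆ S := fun y hy =>
        (Finset.mem_insert.1 (hUS hy)).resolve_left fun h => hxU (h ▸ hy)
      rcases h.cover U hUS' hU with ⟨R', hR'⟩ | ⟨hU₀, y, hy, hyU⟩ | ⟨y, hy, z, hz, hyz, hyzU⟩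
      -- If the region of `U` is the one just consumed, `x` is a common neighbour of `U`, and `apex`
      -- supplies an earlier second one unless `U` is the base triangle.
      · by_cases heq : (U, R') = (({u, v, w} : Finset V), R)
        · right
          have hUeq : U = {u, v, w} := congrArg Prod.fst heq
          have hxU' : ∀ t ∈ U, G.Adj x t := fun t ht => (hadj t (hUS' ht)).2 (hUeq ▸ ht)
          rcases h.apex _ hR' with hU₀ | ⟨y, hy, hyU⟩
          · exact Or.inl ⟨hU₀, x, Finset.mem_insert_self _ _, hxU'⟩
          · exact Or.inr ⟨x, Finset.mem_insert_self _ _, y, Finset.mem_insert_of_mem hy,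
              fun h => hx (h ▸ hy), fun t ht => ⟨hxU' t ht, hyU t ht⟩⟩
        · exact Or.inl ⟨R', Or.inr (Or.inr (Or.inr ⟨hR', heq⟩))⟩
      · exact Or.inr (Or.inl ⟨hU₀, y, Finset.mem_insert_of_mem hy, hyU⟩)
      · exact Or.inr (Or.inr ⟨y, Finset.mem_insert_of_mem hy, z, Finset.mem_insert_of_mem hz, hyz,
          hyzU⟩)

/-- In a planar graph, a triangle does not have three common neighbours. -/
theorem IsPlanarGraph.not_three_common_neighbors (hG : IsPlanarGraph G) (hT : G.IsNClique 3 T)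
    {x y z : V} (hxy : x ≠ y) (hxz : x ≠ z) (hyz : y ≠ z) (hx : ∀ t ∈ T, G.Adj x t)
    (hy : ∀ t ∈ T, G.Adj y t) (hz : ∀ t ∈ T, G.Adj z t) : False := by
  obtain ⟨u, v, w, huv, huw, hvw, rfl⟩ := SimpleGraph.is3Clique_iff.1 hT
  have inj : ∀ {a b c : V}, a ≠ b → a ≠ c → b ≠ c → Function.Injective ![a, b, c] := by
    intro a b c hab hac hbc i j
    fin_cases i <;> fin_cases j <;> simp [hab, hac, hbc, hab.symm, hac.symm, hbc.symm]
  refine not_isPlanarGraph_of_completeBipartite (inj hxy hxz hyz)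
    (inj huv.ne huw.ne hvw.ne) (fun i j => ?_) hG
  have hmem : ![u, v, w] j ∈ ({u, v, w} : Finset V) := by fin_cases j <;> simp
  fin_cases i
  exacts [hx _ hmem, hy _ hmem, hz _ hmem]

/-- A planar stacked graph has a layout. -/
theorem StackedFrom.exists_isLayout (hS : StackedFrom G T₀ S) (hT₀ : G.IsNClique 3 T₀)
    (hG : IsPlanarGraph G)
    (hunique : ∀ y z, (∀ t ∈ T₀, G.Adj y t) → (∀ t ∈ T₀, G.Adj z t) → y = z) :
    ∃ P 𝓡, IsLayout G T₀ S P 𝓡 := by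
  induction hS with
  | base => exact exists_isLayout_triangle hT₀
  | @step S T x hS hx hTS hT hadj ih =>
    obtain ⟨P, 𝓡, h⟩ := ih
    have hxT : ∀ t ∈ T, G.Adj x t := fun t ht => (hadj t (hTS ht)).2 ht
    -- Without a region for `T`, the new vertex `x` would be a second common neighbour of the base
    -- triangle or a third one of `T`; uniqueness and planarity exclude these cases.
    rcases h.cover T hTS hT with ⟨R, hR⟩ | ⟨rfl, y, hy, hyT⟩ | ⟨y, hy, z, hz, hyz, hyzT⟩
    · exact h.exists_insert hx hTS hT hadj hR
    · exact (hx (hunique x y hxT hyT ▸ hy)).elim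
    · exact (hG.not_three_common_neighbors hT (ne_of_mem_of_not_mem hy hx).symm
        (ne_of_mem_of_not_mem hz hx).symm hyz hxT (fun t ht => (hyzT t ht).1) fun t ht => (hyzT t ht).2).elim

end Layout

/-- Every planar 3-tree is an {L}-graph. -/
theorem theorem2 {V : Type*} [Finite V] (G : SimpleGraph V)
    (hplanar : IsPlanarGraph G) (htree : IsKTree 3 G) :
    IsLGraph G := by
  classical
  have := Fintype.ofFinite V
  obtain ⟨T, hT, hstack⟩ := htree.exists_stackedFrom
  obtain ⟨T₀, hT₀, hstack₀, hunique⟩ := hstack.exists_base_unique_common_neighbor hT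
  obtain ⟨P, 𝓡, h⟩ := hstack₀.exists_isLayout hT₀ hplanar hunique
  exact ⟨P, fun u v huv => h.adj_iff u (Finset.mem_univ u) v (Finset.mem_univ v) huv⟩
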